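/- \textbf{Proposition (Nashed, Schock).} For a bounded linear operator $A : X \to Y$ between Banach spaces write $\mathcal{R}(A)$ for its range and $\mathcal{N}(A)$ for its null-space. A closed subspace of a normed space is called \emph{complemented} if it is the range of a bounded linear projection (in a Banach space, equivalently, if it has a closed algebraic complement). The operator $A$ is called \emph{well-posed} if $\mathcal{R}(A)$ is closed in $Y$ and $\mathcal{N}(A)$ is complemented in $X$, and \emph{ill-posed} otherwise. An ill-posed operator $A$ is called \emph{(NV)-type I} if there is an infinite-dimensional closed subspace $M \subset \mathcal{R}(A)$ of $Y$ such that $\mathcal{N}(A)$ is complemented in $A^{-1}[M]$ and $M$ is complemented in $Y$; an ill-posed operator that is not (NV)-type I is called \emph{(NV)-type II}. Let $c_0$ be the space of null sequences and $\ell^\infty$ the space of bounded sequences, with real or with complex scalars and the supremum norm, and let $A : c_0 \to \ell^\infty$ be a bounded linear operator. Then there is no infinite-dimensional closed subspace $M \subset \mathcal{R}(A)$ of $\ell^\infty$ such that $\mathcal{N}(A)$ is complemented in $A^{-1}[M]$ and $M$ is complemented in $\ell^\infty$. In particular $A$ is never (NV)-type I, and consequently $A$ is either well-posed or (NV)-type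 II (and not both). -/

import Mathlib

open scoped ENNReal ZeroAtInfty

section NashedTypes

variable {𝕜 : Type*} [RCLike 𝕜]
  {X : Type*} [NormedAddCommGroup X] [NormedSpace 𝕜 X]
  {Y : Type*} [NormedAddCommGroup Y] [NormedSpace 𝕜 Y]

/-- The preimage `A⁻¹[M]` of a subspace `M` of `Y`, as a subspace of `X`. -/
def preimageSubspace (A : X →L[𝕜] Y) (M : Submodule 𝕜 Y) : Submodule 𝕜 X :=
  M.comap (A : X →ₗ[𝕜] Y)

/-- The null-space `N(A)`, regarded as a subspace of the normed space `A⁻¹[M]`. -/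
def nullSpaceInPreimage (A : X →L[𝕜] Y) (M : Submodule 𝕜 Y) :
    Submodule 𝕜 (preimageSubspace A M) :=
  (LinearMap.ker (A : X →ₗ[𝕜] Y)).submoduleOf (preimageSubspace A M)

/-- A bounded operator is well-posed if its range is closed and its null-space is complemented.
Here and below, "complemented" is Mathlib's `Submodule.ClosedComplemented` (existence of a bounded
projection), which for a closed subspace of a Banach space is the same as the existence of a closed
algebraic complement
(`Submodule.closedComplemented_iff_isClosed_exists_isClosed_isCompl`). -/
def IsWellPosed (A : X →L[𝕜] Y) : Prop :=
  IsClosed (LinearMap.range (A : X →ₗ[𝕜] Y) : Set Y) ∧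
    (LinearMap.ker (A : X →ₗ[𝕜] Y)).ClosedComplemented

/-- A bounded operator is ill-posed if it is not well-posed. -/
def IsIllPosed (A : X →L[𝕜] Y) : Prop := ¬ IsWellPosed A

/-- `M` is an infinite-dimensional closed subspace of `Y` contained in the range of `A`, it is
complemented in `Y`, and `N(A)` is complemented in `A⁻¹[M]`. -/
structure IsNVSubspace (A : X →L[𝕜] Y) (M : Submodule 𝕜 Y) : Prop where
  le_range : M ≤ LinearMap.range (A : X →ₗ[𝕜] Y)
  isClosed : IsClosed (M : Set Y)
  infinite_dimensional : ¬ FiniteDimensional 𝕜 M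
  ker_complemented : (nullSpaceInPreimage A M).ClosedComplemented
  complemented : M.ClosedComplemented

/-- (NV)-type I ill-posedness. -/
def IsNVTypeI (A : X →L[𝕜] Y) : Prop :=
  IsIllPosed A ∧ ∃ M : Submodule 𝕜 Y, IsNVSubspace A M

/-- (NV)-type II ill-posedness: ill-posed, but not of (NV)-type I. -/
def IsNVTypeII (A : X →L[𝕜] Y) : Prop :=
  IsIllPosed A ∧ ¬ IsNVTypeI A

end NashedTypes

/-! A subspace `M` as excluded gives, by the open mapping theorem, a bounded `T : ℓ^∞ → c₀` of
infinite rank with `T A T = T`, so `T A` is the identity on the infinite-dimensional space `Z =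
range T`. A gliding hump picks unit vectors `z_j ∈ Z` behaving like the unit vector basis of `c₀`:
the sums `∑_j |z_j(k)|` are bounded uniformly in `k`. Hence `V a = ∑ a_j z_j` and `S a = ∑ a_j A
z_j`, taken coordinatewise, are bounded operators from `ℓ^∞` to itself, and `T S` agrees with `V` on
unit vectors.

Whitley's argument for the Phillips–Sobczyk theorem (`c₀` is not complemented in `ℓ^∞`) now applies:
the coordinates of `T S - V` are countably many functionals killing the unit vectors, so they all
vanish on the indicator of some infinite `D`. Thus `V 1_D = T S 1_D` lies in `c₀`, although it stays
away from zero at the peaks of the `z_n`, `n ∈ D`. -/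

open Filter Topology

/-! ### Outer inverses from complemented subspaces -/

section ComplementedRange

variable {𝕜 : Type*} [RCLike 𝕜]
  {X : Type*} [NormedAddCommGroup X] [NormedSpace 𝕜 X]
  {Y : Type*} [NormedAddCommGroup Y] [NormedSpace 𝕜 Y]

/-- If `A` admits a Nashed–Votruba subspace, then `A` has a bounded outer inverse of infinite rank:
an operator `T` with `T ∘ A ∘ T = T`. -/
theorem IsNVSubspace.exists_infinite_rank_outer_inverse [CompleteSpace X] [CompleteSpace Y]
    {A : X →L[𝕜] Y} {M : Submodule 𝕜 Y} (h : IsNVSubspace A M) :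
    ∃ T : Y →L[𝕜] X, ¬ FiniteDimensional 𝕜 (LinearMap.range (T : Y →ₗ[𝕜] X)) ∧
      ∀ y, T (A (T y)) = T y := by
  obtain ⟨Q, hQ⟩ := h.ker_complemented
  obtain ⟨P, hP⟩ := h.complemented
  have hN : IsClosed (preimageSubspace A M : Set X) := h.isClosed.preimage A.continuous
  have : CompleteSpace M := h.isClosed.completeSpace_coe
  have : CompleteSpace (preimageSubspace A M) := hN.completeSpace_coe
  -- `Z` is a closed complement of the null-space in `A⁻¹[M]`, so `A` maps it bijectively onto `M`.
  let Z : Submodule 𝕜 (preimageSubspace A M) :=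
    LinearMap.ker (Q : preimageSubspace A M →ₗ[𝕜] nullSpaceInPreimage A M)
  have hZ : IsClosed (Z : Set (preimageSubspace A M)) := Q.isClosed_ker
  have : CompleteSpace Z := hZ.completeSpace_coe
  let g : Z →L[𝕜] M :=
    (A.comp ((preimageSubspace A M).subtypeL.comp Z.subtypeL)).codRestrict M (fun z => z.1.2)
  have hg : ∀ z : Z, ((g z : M) : Y) = A z.1.1 := fun z => rfl
  have hker : LinearMap.ker (g : Z →ₗ[𝕜] M) = ⊥ := by
    rw [LinearMap.ker_eq_bot']
    intro z hz
    have h1 : A z.1.1 = 0 := by rw [← hg]; exact congrArg Subtype.val hz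
    have h2 : z.1 ∈ nullSpaceInPreimage A M := h1
    have h3 := hQ ⟨z.1, h2⟩
    have h4 : Q z.1 = 0 := z.2
    have h5 : z.1 = 0 := by
      have := congrArg Subtype.val h3
      simpa [h4] using this.symm
    exact Subtype.ext h5
  have hrange : LinearMap.range (g : Z →ₗ[𝕜] M) = ⊤ := by
    rw [LinearMap.range_eq_top]
    intro m
    obtain ⟨x, hx⟩ := h.le_range m.2
    have hxN : x ∈ preimageSubspace A M := by
      change A x ∈ M
      change A x = _ at hx
      rw [hx]; exact m.2
    let x' : preimageSubspace A M := ⟨x, hxN⟩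
    refine ⟨⟨x' - (Q x' : preimageSubspace A M), ?_⟩, ?_⟩
    · change Q (x' - (Q x' : preimageSubspace A M)) = 0
      rw [map_sub, hQ, sub_self]
    · apply Subtype.ext
      have h0 : A ((Q x' : preimageSubspace A M) : X) = 0 := (Q x').2
      change A (x - ((Q x' : preimageSubspace A M) : X)) = m
      rw [map_sub, h0, sub_zero]
      exact hx
  let e : Z ≃L[𝕜] M := ContinuousLinearEquiv.ofBijective g hker hrange
  have hAe : ∀ m : M, A ((e.symm m).1.1) = m := fun m => by
    rw [← hg]
    exact congrArg Subtype.val (e.apply_symm_apply m)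
  let T : Y →L[𝕜] X := ((preimageSubspace A M).subtypeL.comp Z.subtypeL).comp
    ((e.symm : M →L[𝕜] Z).comp P)
  have hT : ∀ y, T y = (e.symm (P y)).1.1 := fun y => rfl
  refine ⟨T, fun hfin => h.infinite_dimensional ?_, fun y => ?_⟩
  · let f : M →ₗ[𝕜] LinearMap.range (T : Y →ₗ[𝕜] X) :=
      (T : Y →ₗ[𝕜] X).rangeRestrict.comp M.subtype
    refine FiniteDimensional.of_injective f fun m m' hmm => ?_
    have h1 : T m = T m' :=
      congrArg (Subtype.val : LinearMap.range (T : Y →ₗ[𝕜] X) → X) hmm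
    have h2 := congrArg A h1
    rw [hT, hT, hAe, hAe, hP, hP] at h2
    exact Subtype.ext h2
  · rw [hT (A (T y)), hT y, hAe, hP]

end ComplementedRange

/-! ### Almost disjoint sets of integers -/

section AlmostDisjoint

/-- There is a family of infinite subsets of `ℕ`, indexed by the Cantor space, with pairwise finite
intersections. -/
theorem exists_almostDisjoint_family :
    ∃ D : (ℕ → Bool) → Set ℕ, (∀ x, (D x).Infinite) ∧ ∀ x y, x ≠ y → (D x ∩ D y).Finite := by
  -- Codes of the initial segments of a branch: distinct branches share only those before they
  -- split.
  let c : (ℕ → Bool) → ℕ → ℕ := fun x n => Encodable.encode ((List.range n).map x)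
  have hc : ∀ {x y n m}, c x n = c y m → n = m ∧ ∀ i < n, x i = y i := by
    intro x y n m h
    have h1 : (List.range n).map x = (List.range m).map y := Encodable.encode_injective h
    have h2 : n = m := by simpa using congrArg List.length h1
    subst h2
    refine ⟨rfl, fun i hi => ?_⟩
    exact List.map_inj_left.1 h1 i (List.mem_range.2 hi)
  refine ⟨fun x => Set.range (c x), fun x => Set.infinite_range_of_injective fun n m h => (hc h).1,
    fun x y hxy => ?_⟩
  obtain ⟨i, hi⟩ := Function.ne_iff.1 hxy
  refine ((Set.finite_Iic i).image (c x)).subset ?_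
  rintro k ⟨⟨n, rfl⟩, ⟨m, hm⟩⟩
  refine ⟨n, ?_, rfl⟩
  by_contra hn
  exact hi ((hc hm.symm).2 i (not_le.1 hn))

end AlmostDisjoint

/-! ### Functionals and matrix operators on `ℓ^∞` -/

section BoundedSequences

variable {𝕜 : Type*} [RCLike 𝕜]

/-- The indicator function of a set of natural numbers, as a bounded sequence. -/
noncomputable def linftyIndicator (𝕜 : Type*) [RCLike 𝕜] (S : Set ℕ) : lp (fun _ : ℕ => 𝕜) ∞ :=
  ⟨S.indicator 1, memℓp_infty ⟨1, by
    rintro _ ⟨i, rfl⟩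
    by_cases h : i ∈ S <;> simp [h]⟩⟩

theorem linftyIndicator_apply (S : Set ℕ) (i : ℕ) :
    linftyIndicator 𝕜 S i = S.indicator (1 : ℕ → 𝕜) i := rfl

theorem linftyIndicator_union {S T : Set ℕ} (h : Disjoint S T) :
    linftyIndicator 𝕜 (S ∪ T) = linftyIndicator 𝕜 S + linftyIndicator 𝕜 T := by
  ext i
  simp only [lp.coeFn_add, Pi.add_apply, linftyIndicator_apply]
  exact congrFun (Set.indicator_union_of_disjoint h (1 : ℕ → 𝕜)) i

theorem map_linftyIndicator_of_finite {f : lp (fun _ : ℕ => 𝕜) ∞ →L[𝕜] 𝕜}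
    (hf : ∀ n, f (linftyIndicator 𝕜 {n}) = 0) {S : Set ℕ} (hS : S.Finite) :
    f (linftyIndicator 𝕜 S) = 0 := by
  induction S, hS using Set.Finite.induction_on with
  | empty =>
    have : linftyIndicator 𝕜 ∅ = 0 := by
      ext i
      simp [linftyIndicator_apply]
    rw [this, map_zero]
  | @insert a s ha _ ih =>
    rw [Set.insert_eq, linftyIndicator_union (by simpa using ha), map_add, hf, ih, add_zero]

/-- A functional vanishing on the unit vectors is summable, with sum at most its norm, over the
indicators of an almost disjoint family. -/
theorem sum_norm_map_linftyIndicator_le {ι : Type*} {D : ι → Set ℕ}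
    (hD : ∀ x y, x ≠ y → (D x ∩ D y).Finite) {f : lp (fun _ : ℕ => 𝕜) ∞ →L[𝕜] 𝕜}
    (hf : ∀ n, f (linftyIndicator 𝕜 {n}) = 0) (F : Finset ι) :
    ∑ x ∈ F, ‖f (linftyIndicator 𝕜 (D x))‖ ≤ ‖f‖ := by
  classical
  -- All pairwise overlaps within `F`: deleting this finite set makes the `D x` disjoint and does
  -- not change the values of `f`.
  let E : Set ℕ := ⋃ x ∈ F, ⋃ y ∈ F.erase x, D x ∩ D y
  have hE : E.Finite := F.finite_toSet.biUnion fun x _ =>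
    (F.erase x).finite_toSet.biUnion fun y hy => hD x y (Finset.ne_of_mem_erase hy).symm
  have hfE : ∀ x, f (linftyIndicator 𝕜 (D x)) = f (linftyIndicator 𝕜 (D x \ E)) := fun x => by
    rw [← Set.sdiff_union_inter (D x) E,
      linftyIndicator_union (Set.disjoint_sdiff_inter),
      map_add, map_linftyIndicator_of_finite hf (hE.subset Set.inter_subset_right), add_zero,
      Set.sdiff_union_inter]
  choose s hs1 hs2 using fun x => RCLike.exists_norm_eq_mul_self (f (linftyIndicator 𝕜 (D x)))
  let u : lp (fun _ : ℕ => 𝕜) ∞ := ∑ x ∈ F, s x • linftyIndicator 𝕜 (D x \ E)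
  have hu : ‖u‖ ≤ 1 := by
    refine lp.norm_le_of_forall_le zero_le_one fun k => ?_
    have huk : u k = ∑ x ∈ F, s x * (D x \ E).indicator (1 : ℕ → 𝕜) k := by
      simp only [u, lp.coeFn_sum, Finset.sum_apply, lp.coeFn_smul, Pi.smul_apply,
        linftyIndicator_apply, smul_eq_mul]
    rw [huk]
    by_cases hk : ∃ x ∈ F, k ∈ D x \ E
    · obtain ⟨x, hx, hkx⟩ := hk
      rw [Finset.sum_eq_single_of_mem x hx]
      · simp [hkx, hs1]
      · intro y hy hyx
        rw [Set.indicator_of_notMem, mul_zero]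
        intro hky
        refine hkx.2 ?_
        simp only [E, Set.mem_iUnion]
        exact ⟨x, hx, y, Finset.mem_erase.2 ⟨hyx, hy⟩, hkx.1, hky.1⟩
    · push Not at hk
      rw [Finset.sum_eq_zero]
      · simp
      · intro x hx
        rw [Set.indicator_of_notMem (hk x hx), mul_zero]
  have hfu : f u = ((∑ x ∈ F, ‖f (linftyIndicator 𝕜 (D x))‖ : ℝ) : 𝕜) := by
    simp only [u, map_sum, map_smul, smul_eq_mul]
    refine Finset.sum_congr rfl fun x _ => ?_
    rw [← hfE]
    exact (hs2 x).symm
  have h := f.le_of_opNorm_le_of_le le_rfl hu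
  rwa [hfu, mul_one, RCLike.norm_ofReal,
    abs_of_nonneg (Finset.sum_nonneg fun _ _ => norm_nonneg _)] at h

/-- Countably many functionals on `ℓ^∞` that vanish on the unit vectors vanish simultaneously on the
indicator of some infinite set. -/
theorem exists_infinite_forall_map_linftyIndicator_eq_zero
    {f : ℕ → lp (fun _ : ℕ => 𝕜) ∞ →L[𝕜] 𝕜}
    (hf : ∀ k n, f k (linftyIndicator 𝕜 {n}) = 0) :
    ∃ S : Set ℕ, S.Infinite ∧ ∀ k, f k (linftyIndicator 𝕜 S) = 0 := by
  obtain ⟨D, hDinf, hD⟩ := exists_almostDisjoint_family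
  -- Each functional excludes only countably many of the uncountably many indices.
  have hcount : ∀ k, {x | f k (linftyIndicator 𝕜 (D x)) ≠ 0}.Countable := fun k => by
    have hsum : Summable fun x => ‖f k (linftyIndicator 𝕜 (D x))‖ :=
      summable_of_sum_le (fun _ => norm_nonneg _) (sum_norm_map_linftyIndicator_le hD (hf k))
    refine hsum.countable_support.mono fun x hx => ?_
    simpa using hx
  have huncount : ¬ (Set.univ : Set (ℕ → Bool)).Countable := by
    rw [Set.countable_univ_iff, ← Cardinal.mk_le_aleph0_iff]
    simp [Cardinal.aleph0_lt_continuum]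
  by_contra! hcon
  refine huncount ((Set.countable_iUnion hcount).mono fun x _ => ?_)
  obtain ⟨k, hk⟩ := hcon (D x) (hDinf x)
  exact Set.mem_iUnion.2 ⟨k, hk⟩

/-- The operator on `ℓ^∞` given by an infinite matrix with uniformly absolutely summable
columns. -/
theorem exists_linfty_matrix_operator {b : ℕ → ℕ → 𝕜} {C : ℝ}
    (hb : ∀ (k : ℕ) (F : Finset ℕ), ∑ j ∈ F, ‖b j k‖ ≤ C) :
    ∃ L : lp (fun _ : ℕ => 𝕜) ∞ →L[𝕜] lp (fun _ : ℕ => 𝕜) ∞,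
      ∀ a k, L a k = ∑' j, a j * b j k := by
  have hsum : ∀ k, Summable fun j => ‖b j k‖ := fun k =>
    summable_of_sum_le (fun _ => norm_nonneg _) (hb k)
  have hle : ∀ (a : lp (fun _ : ℕ => 𝕜) ∞) j k, ‖a j * b j k‖ ≤ ‖a‖ * ‖b j k‖ := fun a j k => by
    rw [norm_mul]
    gcongr
    exact lp.norm_apply_le_norm ENNReal.top_ne_zero a j
  have hsum' : ∀ (a : lp (fun _ : ℕ => 𝕜) ∞) k, Summable fun j => a j * b j k := fun a k =>
    Summable.of_norm_bounded ((hsum k).mul_left _) (hle a · k)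
  have hC : 0 ≤ C := by simpa using hb 0 ∅
  have hbound : ∀ (a : lp (fun _ : ℕ => 𝕜) ∞) k, ‖∑' j, a j * b j k‖ ≤ C * ‖a‖ := fun a k => by
    refine (tsum_of_norm_bounded ((hsum k).hasSum.mul_left ‖a‖) (hle a · k)).trans ?_
    rw [mul_comm]
    gcongr
    exact Real.tsum_le_of_sum_le (fun _ => norm_nonneg _) (hb k)
  let L : lp (fun _ : ℕ => 𝕜) ∞ →ₗ[𝕜] lp (fun _ : ℕ => 𝕜) ∞ :=
    { toFun := fun a => ⟨fun k => ∑' j, a j * b j k, memℓp_infty ⟨C * ‖a‖, by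
        rintro _ ⟨k, rfl⟩
        exact hbound a k⟩⟩
      map_add' := fun a a' => by
        ext k
        change ∑' j, (a + a') j * b j k = ∑' j, a j * b j k + ∑' j, a' j * b j k
        rw [← (hsum' a k).tsum_add (hsum' a' k)]
        simp [add_mul]
      map_smul' := fun c a => by
        ext k
        change ∑' j, (c • a) j * b j k = c * ∑' j, a j * b j k
        rw [← tsum_mul_left]
        simp [mul_assoc] }
  exact ⟨L.mkContinuous C fun a =>
    lp.norm_le_of_forall_le (by positivity) fun k => hbound a k, fun a k => rfl⟩

theorem tsum_linftyIndicator_singleton_mul (n : ℕ) (b : ℕ → 𝕜) :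
    ∑' j, linftyIndicator 𝕜 {n} j * b j = b n := by
  rw [tsum_eq_single n]
  · simp [linftyIndicator_apply]
  · intro j hj
    simp [linftyIndicator_apply, hj]

end BoundedSequences

/-! ### Gliding hump in `c₀` -/

section NullSequences

variable {𝕜 : Type*} [RCLike 𝕜]

theorem ZeroAtInftyContinuousMap.norm_apply_le_norm (z : C₀(ℕ, 𝕜)) (k : ℕ) : ‖z k‖ ≤ ‖z‖ :=
  z.toBCF.norm_coe_le_norm k

theorem ZeroAtInftyContinuousMap.norm_le_of_forall_le {z : C₀(ℕ, 𝕜)} {C : ℝ} (hC : 0 ≤ C)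
    (h : ∀ k, ‖z k‖ ≤ C) : ‖z‖ ≤ C :=
  (BoundedContinuousFunction.norm_le (f := z.toBCF) hC).2 h

theorem ZeroAtInftyContinuousMap.tendsto_atTop (z : C₀(ℕ, 𝕜)) : Tendsto z atTop (𝓝 0) := by
  have := z.zero_at_infty'
  rwa [cocompact_eq_cofinite, Nat.cofinite_eq_atTop] at this

/-- Evaluation at a point, as a bounded functional on `c₀`. -/
noncomputable def nullSequenceEval (𝕜 : Type*) [RCLike 𝕜] (k : ℕ) : C₀(ℕ, 𝕜) →L[𝕜] 𝕜 :=
  LinearMap.mkContinuous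
    { toFun := fun z => z k
      map_add' := fun _ _ => rfl
      map_smul' := fun _ _ => rfl } 1 fun z => by
      rw [one_mul]
      exact z.norm_apply_le_norm k

theorem nullSequenceEval_apply (k : ℕ) (z : C₀(ℕ, 𝕜)) : nullSequenceEval 𝕜 k z = z k := rfl

/-- An infinite-dimensional space of null sequences contains unit vectors vanishing on any given
initial segment. -/
theorem exists_unit_vector_vanishing_below {Z : Submodule 𝕜 C₀(ℕ, 𝕜)}
    (hZ : ¬ FiniteDimensional 𝕜 Z) (N : ℕ) : ∃ z ∈ Z, ‖z‖ = 1 ∧ ∀ k < N, z k = 0 := by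
  let r : Z →ₗ[𝕜] (Fin N → 𝕜) :=
    LinearMap.pi fun i => (nullSequenceEval 𝕜 i : C₀(ℕ, 𝕜) →ₗ[𝕜] 𝕜).comp Z.subtype
  -- Restriction to the first `N` coordinates has a finite-dimensional target.
  have hr : ¬ Function.Injective r := fun h => hZ (FiniteDimensional.of_injective r h)
  rw [injective_iff_map_eq_zero] at hr
  push Not at hr
  obtain ⟨z, hz, hz0⟩ := hr
  have hz0' : (z : C₀(ℕ, 𝕜)) ≠ 0 := fun h => hz0 (Subtype.ext h)
  refine ⟨((‖(z : C₀(ℕ, 𝕜))‖ : 𝕜)⁻¹) • (z : C₀(ℕ, 𝕜)), Z.smul_mem _ z.2,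
    norm_smul_inv_norm hz0', fun k hk => ?_⟩
  have : (z : C₀(ℕ, 𝕜)) k = 0 := congrFun hz ⟨k, hk⟩
  simp [this]

/-- Gliding hump: an infinite-dimensional space of null sequences contains unit vectors that are
almost disjoint. -/
theorem exists_almost_disjoint_unit_vectors {Z : Submodule 𝕜 C₀(ℕ, 𝕜)}
    (hZ : ¬ FiniteDimensional 𝕜 Z) {ε : ℕ → ℝ} (hε : ∀ n, 0 < ε n) :
    ∃ z : ℕ → C₀(ℕ, 𝕜), (∀ n, z n ∈ Z) ∧ (∀ n, ‖z n‖ = 1) ∧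
      ∀ k, ∃ m, ∀ j, j ≠ m → ‖z j k‖ ≤ ε j := by
  choose ζ hζZ hζ1 hζ0 using exists_unit_vector_vanishing_below hZ
  have hnext : ∀ N n, ∃ N', N < N' ∧ ∀ k, N' ≤ k → ‖ζ N k‖ ≤ ε n := fun N n => by
    have h := (ζ N).tendsto_atTop.norm
    rw [norm_zero] at h
    obtain ⟨K, hK⟩ := eventually_atTop.1 (h.eventually (gt_mem_nhds (hε n)))
    exact ⟨max K (N + 1), by omega, fun k hk => (hK k (by omega)).le⟩
  choose next hlt hnext using hnext
  -- `ζ (B n)` vanishes before `B n` and is at most `ε n` from `B (n + 1)` on, so only the block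
  -- containing `k` can be exceptional.
  let B : ℕ → ℕ := fun n => Nat.rec 0 (fun n N => next N n) n
  have hBs : ∀ n, B (n + 1) = next (B n) n := fun n => rfl
  have hB : StrictMono B := strictMono_nat_of_lt_succ fun n => hlt _ _
  refine ⟨fun n => ζ (B n), fun n => hζZ _, fun n => hζ1 _, fun k => ?_⟩
  have hex : ∃ m, k < B (m + 1) := ⟨k, Nat.lt_of_lt_of_le k.lt_succ_self hB.le_apply⟩
  classical
  refine ⟨Nat.find hex, fun j hj => ?_⟩
  rcases lt_or_gt_of_ne hj with h | h
  · have := Nat.find_min hex h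
    exact hnext (B j) j k (by rw [← hBs]; omega)
  · have h1 : k < B j := (Nat.find_spec hex).trans_le (hB.monotone h)
    rw [hζ0 _ _ h1, norm_zero]
    exact (hε j).le

end NullSequences

/-! ### Contradiction with factorization through `ℓ^∞` -/

section Main

variable {𝕜 : Type*} [RCLike 𝕜]

/-- Unimodular coefficients turn the sum into one coordinate of `A` applied to a combination of the
`z j` of norm at most `C`. This makes the matrix of the `A (z j)` define an operator on `ℓ^∞`. -/
theorem sum_norm_map_apply_le (A : C₀(ℕ, 𝕜) →L[𝕜] lp (fun _ : ℕ => 𝕜) ∞) {z : ℕ → C₀(ℕ, 𝕜)}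
    {C : ℝ} (hz : ∀ (k : ℕ) (F : Finset ℕ), ∑ j ∈ F, ‖z j k‖ ≤ C) (k : ℕ) (F : Finset ℕ) :
    ∑ j ∈ F, ‖A (z j) k‖ ≤ ‖A‖ * C := by
  choose s hs1 hs2 using fun j => RCLike.exists_norm_eq_mul_self (A (z j) k)
  have hC : 0 ≤ C := by simpa using hz 0 ∅
  have hnorm : ‖∑ j ∈ F, s j • z j‖ ≤ C := by
    refine ZeroAtInftyContinuousMap.norm_le_of_forall_le hC fun l => ?_
    rw [← nullSequenceEval_apply, map_sum]
    refine (norm_sum_le _ _).trans ?_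
    refine le_trans (le_of_eq (Finset.sum_congr rfl fun j _ => ?_)) (hz l F)
    rw [map_smul, norm_smul, hs1, one_mul, nullSequenceEval_apply]
  have hA : A (∑ j ∈ F, s j • z j) k = ((∑ j ∈ F, ‖A (z j) k‖ : ℝ) : 𝕜) := by
    push_cast
    simp only [map_sum, map_smul, lp.coeFn_sum, Finset.sum_apply, lp.coeFn_smul, Pi.smul_apply,
      smul_eq_mul, hs2]
  have h := (lp.norm_apply_le_norm ENNReal.top_ne_zero (A (∑ j ∈ F, s j • z j)) k).trans
    (A.le_of_opNorm_le_of_le le_rfl hnorm)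
  rwa [hA, RCLike.norm_ofReal,
    abs_of_nonneg (Finset.sum_nonneg fun _ _ => norm_nonneg _)] at h

/-- No infinite-dimensional subspace of `c₀` is fixed by an operator factoring through `ℓ^∞`. -/
theorem finiteDimensional_of_comp_linfty_eq_self (A : C₀(ℕ, 𝕜) →L[𝕜] lp (fun _ : ℕ => 𝕜) ∞)
    (T : lp (fun _ : ℕ => 𝕜) ∞ →L[𝕜] C₀(ℕ, 𝕜)) {Z : Submodule 𝕜 C₀(ℕ, 𝕜)}
    (hTA : ∀ z ∈ Z, T (A z) = z) : FiniteDimensional 𝕜 Z := by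
  by_contra hZ
  -- Total error `1/4`, so peaks above `1/2` keep modulus at least `1/4`.
  let ε : ℕ → ℝ := fun n => 1 / 4 / 2 / 2 ^ n
  have hεpos : ∀ n, 0 < ε n := fun n => by positivity
  have hεsum : HasSum ε (1 / 4) := hasSum_geometric_two' _
  have hεF : ∀ F : Finset ℕ, ∑ j ∈ F, ε j ≤ 1 / 4 := fun F =>
    sum_le_hasSum F (fun j _ => (hεpos j).le) hεsum
  obtain ⟨z, hzZ, hz1, hz⟩ := exists_almost_disjoint_unit_vectors hZ hεpos
  have hcol : ∀ (k : ℕ) (F : Finset ℕ), ∑ j ∈ F, ‖z j k‖ ≤ 1 + 1 / 4 := fun k F => by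
    obtain ⟨m, hm⟩ := hz k
    calc ∑ j ∈ F, ‖z j k‖ ≤ ∑ j ∈ insert m F, ‖z j k‖ :=
          Finset.sum_le_sum_of_subset_of_nonneg (Finset.subset_insert _ _)
            fun _ _ _ => norm_nonneg _
      _ = ‖z m k‖ + ∑ j ∈ (insert m F).erase m, ‖z j k‖ :=
          (Finset.add_sum_erase _ _ (Finset.mem_insert_self _ _)).symm
      _ ≤ 1 + 1 / 4 := by
          gcongr
          · exact ((z m).norm_apply_le_norm k).trans (hz1 m).le
          · exact (Finset.sum_le_sum fun j hj => hm j (Finset.ne_of_mem_erase hj)).trans (hεF _)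
  have hpeak : ∀ n, ∃ k, 1 / 2 < ‖z n k‖ := fun n => by
    by_contra! h
    have := ZeroAtInftyContinuousMap.norm_le_of_forall_le (by norm_num) h
    rw [hz1] at this
    norm_num at this
  choose p hp using hpeak
  have hε2 : ∀ n, ε n ≤ 1 / 2 := fun n =>
    (le_hasSum hεsum n fun j _ => (hεpos j).le).trans (by norm_num)
  -- Since `‖z n (p n)‖` exceeds `1/2 ≥ ε n`, the exceptional index at `p n` can only be `n`.
  have hpn : ∀ n j, j ≠ n → ‖z j (p n)‖ ≤ ε j := fun n => by
    obtain ⟨m, hm⟩ := hz (p n)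
    have : n = m := by
      by_contra hne
      exact absurd ((hm n hne).trans (hε2 n)) (not_le.2 (hp n))
    rwa [← this] at hm
  have hpinj : Function.Injective p := fun n n' h => by
    by_contra hne
    have h1 := (hpn n' n hne).trans (hε2 n)
    rw [← h] at h1
    exact absurd h1 (not_le.2 (hp n))
  obtain ⟨S, hS⟩ := exists_linfty_matrix_operator (sum_norm_map_apply_le A hcol)
  obtain ⟨V, hV⟩ := exists_linfty_matrix_operator hcol
  have hSn : ∀ n, S (linftyIndicator 𝕜 {n}) = A (z n) := fun n => by
    ext k
    rw [hS, tsum_linftyIndicator_singleton_mul]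
  obtain ⟨D, hDinf, hD⟩ := exists_infinite_forall_map_linftyIndicator_eq_zero
    (f := fun k => (nullSequenceEval 𝕜 k).comp (T.comp S) -
      (lp.evalCLM 𝕜 (fun _ : ℕ => 𝕜) ∞ k).comp V) (fun k n => by
        change T (S (linftyIndicator 𝕜 {n})) k - V (linftyIndicator 𝕜 {n}) k = 0
        rw [hSn, hTA _ (hzZ n), hV, tsum_linftyIndicator_singleton_mul, sub_self])
  have hTV : ∀ k, T (S (linftyIndicator 𝕜 D)) k = ∑' j, linftyIndicator 𝕜 D j * z j k :=
    fun k => by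
      rw [← hV]
      exact sub_eq_zero.1 (hD k)
  have hlarge : ∀ n ∈ D, 1 / 4 ≤ ‖T (S (linftyIndicator 𝕜 D)) (p n)‖ := fun n hn => by
    have hle : ∀ j, ‖linftyIndicator 𝕜 D j * z j (p n)‖ ≤ ‖z j (p n)‖ := fun j => by
      by_cases hj : j ∈ D <;> simp [linftyIndicator_apply, hj]
    have hsum : Summable fun j => linftyIndicator 𝕜 D j * z j (p n) :=
      Summable.of_norm_bounded
        (summable_of_sum_le (fun _ => norm_nonneg _) (hcol (p n))) hle
    rw [hTV, hsum.tsum_eq_add_tsum_ite n]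
    have h1 : linftyIndicator 𝕜 D n * z n (p n) = z n (p n) := by
      simp [linftyIndicator_apply, hn]
    have h2 : ‖∑' j, if j = n then 0 else linftyIndicator 𝕜 D j * z j (p n)‖ ≤ 1 / 4 := by
      refine tsum_of_norm_bounded hεsum fun j => ?_
      split_ifs with hj
      · simpa using (hεpos j).le
      · exact (hle j).trans (hpn n j hj)
    rw [h1]
    have h3 := norm_sub_le_norm_add (z n (p n))
      (∑' j, if j = n then 0 else linftyIndicator 𝕜 D j * z j (p n))
    have := hp n
    linarith
  have hlim := (T (S (linftyIndicator 𝕜 D))).tendsto_atTop.norm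
  rw [norm_zero, ← Nat.cofinite_eq_atTop] at hlim
  -- As `p` is injective, a null sequence can be at least `1/4` at `p n` for finitely many `n` only.
  have hev := (hlim.comp hpinj.tendsto_cofinite).eventually
    (gt_mem_nhds (show (0 : ℝ) < 1 / 4 by norm_num))
  refine hDinf ((eventually_cofinite.1 hev).subset fun n hn => ?_)
  exact not_lt.2 (hlarge n hn)

theorem not_isNVSubspace (A : C₀(ℕ, 𝕜) →L[𝕜] lp (fun _ : ℕ => 𝕜) ∞)
    (M : Submodule 𝕜 (lp (fun _ : ℕ => 𝕜) ∞)) : ¬ IsNVSubspace A M := fun h => by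
  obtain ⟨T, hT, hTA⟩ := h.exists_infinite_rank_outer_inverse
  refine hT (finiteDimensional_of_comp_linfty_eq_self A T ?_)
  rintro _ ⟨y, rfl⟩
  exact hTA y

end Main

/-- `C₀(ℕ, 𝕜)` is `c₀` (scalar null sequences with the sup norm), and `lp (fun _ : ℕ => 𝕜) ∞` is
`ℓ^∞`; the scalars `𝕜` are `ℝ` or `ℂ`. -/
theorem mainTheorem4 {𝕜 : Type*} [RCLike 𝕜]
    (A : C₀(ℕ, 𝕜) →L[𝕜] lp (fun _ : ℕ => 𝕜) ∞) :
    (¬ ∃ M : Submodule 𝕜 (lp (fun _ : ℕ => 𝕜) ∞), IsNVSubspace A M) ∧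
      ¬ IsNVTypeI A ∧
      Xor (IsWellPosed A) (IsNVTypeII A) := by
  have hM : ¬ ∃ M : Submodule 𝕜 (lp (fun _ : ℕ => 𝕜) ∞), IsNVSubspace A M :=
    fun ⟨M, h⟩ => not_isNVSubspace A M h
  have hI : ¬ IsNVTypeI A := fun h => hM h.2
  refine ⟨hM, hI, ?_⟩
  by_cases h : IsWellPosed A
  · exact Or.inl ⟨h, fun h' => h'.1 h⟩
  · exact Or.inr ⟨⟨h, hI⟩, h⟩
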